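/- For every integer $n>3$, the product $P_n=\prod_{k=1}^n (k^2+1)$ is not a perfect square. Hence $(b,n)=(10,3)$ is the only solution in positive integers $b,n$ of $\prod_{k=1}^n (k^2+1)=b^2$. Consequently, for a positive integer $n$, the complex number $\prod_{k=1}^n (k+i)$ (where $i^2=-1$) is purely imaginary, that is, has real part $0$, if and only if $n=3$. -/

import Mathlib

/-! If the product is a square, every prime `p` dividing it is below `2n`: a larger one divides only
one factor `k² + 1`, and only once. So the product `P` is smooth, and this makes it too small.

Write `log P` as the sum of `Λ(d) · #{k ≤ n : d ∣ k² + 1}` over `2n`-smooth `d ≤ n² + 1`. For prime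
powers the count is at most `(1 + χ₄(d))(⌊n/d⌋ + 1)` (`card_roots_le`). Mertens-type bounds, for
`Λ(d)/d` and `χ₄(d)Λ(d)/d`, give `n log n + O(n)` for the main term; the `+ 1` costs `O(π(2n) log n)
= O(n)` by Chebyshev. But `P ≥ n!²` gives `log P ≥ 2n log n - 2n`, a contradiction once `log n ≥
90`.

Smaller `n` are covered by a few primes of the form `k² + 1`, each of which divides `P` exactly once
over a long range of `n`. The statement on real parts follows by taking norms. -/

/-! ### Primes dividing the product exactly once; the range `n ≤ 10 ^ 40` -/

/-- `b ^ e % m` by repeated squaring, for exponents `e < 2 ^ f`. -/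
def powMod (m : ℕ) : ℕ → ℕ → ℕ → ℕ
  | 0, _, _ => 1 % m
  | f + 1, b, e => b ^ (e % 2) * powMod m f (b * b % m) (e / 2) % m

theorem powMod_eq (m f b e : ℕ) (he : e < 2 ^ f) : powMod m f b e = b ^ e % m := by
  induction f generalizing b e with
  | zero =>
    have : e = 0 := by simpa using he
    simp [powMod, this]
  | succ f ih =>
    rw [powMod, ih _ _ (by rw [pow_succ] at he; omega), ← Nat.pow_mod, ← pow_two, ← pow_mul,
      Nat.mul_mod_mod, ← pow_add, Nat.mod_add_div]

/-- Lucas' primality criterion for `k ^ 2 + 1` when `2` and `5` are the only prime factors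
of `k`. -/
theorem prime_sq_add_one {k u v : ℕ} (f a : ℕ) (hk : k = 2 ^ u * 5 ^ v) (hf : k ^ 2 < 2 ^ f)
    (h1 : powMod (k ^ 2 + 1) f a (k ^ 2) = 1) (h2 : powMod (k ^ 2 + 1) f a (k ^ 2 / 2) ≠ 1)
    (h5 : powMod (k ^ 2 + 1) f a (k ^ 2 / 5) ≠ 1) : (k ^ 2 + 1).Prime := by
  have hk0 : 1 ≤ k ^ 2 := Nat.one_le_iff_ne_zero.2 (by rw [hk]; positivity)
  have key : ∀ e, e ≤ k ^ 2 →
      ((a : ZMod (k ^ 2 + 1)) ^ e = 1 ↔ powMod (k ^ 2 + 1) f a e = 1) := by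
    intro e he
    have h := ZMod.natCast_eq_natCast_iff' (a ^ e) 1 (k ^ 2 + 1)
    rw [Nat.mod_eq_of_lt (by omega : 1 < k ^ 2 + 1), Nat.cast_pow, Nat.cast_one] at h
    rw [powMod_eq _ _ _ _ (he.trans_lt hf), h]
  refine lucas_primality _ (a : ZMod (k ^ 2 + 1)) ?_ ?_
  · rw [Nat.add_sub_cancel]
    exact (key _ le_rfl).2 h1
  · intro q hq hqk
    rw [Nat.add_sub_cancel] at hqk ⊢
    have hqk := hq.dvd_of_dvd_pow hqk
    rw [hk, hq.dvd_mul] at hqk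
    rw [Ne, key _ (Nat.div_le_self _ _)]
    rcases hqk with h | h
    · rwa [(Nat.prime_dvd_prime_iff_eq hq Nat.prime_two).1 (hq.dvd_of_dvd_pow h)]
    · rwa [(Nat.prime_dvd_prime_iff_eq hq Nat.prime_five).1 (hq.dvd_of_dvd_pow h)]

/-- If `p` also divided `l² + 1`, it would divide `(l - k)(l + k)`, whose factors are nonzero and
smaller than `p` in absolute value. So `p` has exponent one in the product. -/
theorem not_isSquare_prod_of_prime_dvd {n k p : ℕ} (hp : p.Prime) (hk : k ∈ Finset.Icc 1 n)
    (hpk : p ∣ k ^ 2 + 1) (hpk2 : ¬ p ^ 2 ∣ k ^ 2 + 1)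
    (hl : ∀ l ∈ Finset.Icc 1 n, l ≠ k → l + k < p) :
    ¬ IsSquare (∏ k ∈ Finset.Icc 1 n, (k ^ 2 + 1)) := by
  rintro ⟨m, hm⟩
  rw [← Finset.mul_prod_erase _ _ hk] at hm
  have hrest : Nat.Coprime p (∏ l ∈ (Finset.Icc 1 n).erase k, (l ^ 2 + 1)) := by
    refine Nat.Coprime.prod_right fun l hlm => (Nat.Prime.coprime_iff_not_dvd hp).2 fun h => ?_
    obtain ⟨hne, hmem⟩ := Finset.mem_erase.1 hlm
    have hlt := hl l hmem hne
    have hd : (p : ℤ) ∣ ((l : ℤ) - k) * (l + k) := by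
      have e : ((l : ℤ) - k) * (l + k) = (l ^ 2 + 1 : ℕ) - (k ^ 2 + 1 : ℕ) := by
        push_cast
        ring
      rw [e]
      exact dvd_sub (Int.natCast_dvd_natCast.2 h) (Int.natCast_dvd_natCast.2 hpk)
    have h1 := (Finset.mem_Icc.1 hmem).1
    rcases (Nat.prime_iff_prime_int.1 hp).dvd_or_dvd hd with h | h
    · have := Int.eq_zero_of_abs_lt_dvd h (by rw [abs_lt]; constructor <;> omega)
      omega
    · have := Int.le_of_dvd (by omega) h
      omega
  have hpm : p ∣ m := by
    have : p ∣ m * m := hm ▸ hpk.mul_right _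
    exact (or_self_iff).1 (hp.dvd_mul.1 this)
  have : p ^ 2 ∣ m * m := by
    rw [pow_two]
    exact mul_dvd_mul hpm hpm
  rw [← hm] at this
  exact hpk2 ((hrest.pow_left 2).dvd_of_dvd_mul_right this)

theorem not_isSquare_prod_of_prime {n k : ℕ} (hp : (k ^ 2 + 1).Prime) (hk : 1 ≤ k) (hkn : k ≤ n)
    (hn : n + k < k ^ 2 + 1) : ¬ IsSquare (∏ k ∈ Finset.Icc 1 n, (k ^ 2 + 1)) := by
  refine not_isSquare_prod_of_prime_dvd hp (Finset.mem_Icc.2 ⟨hk, hkn⟩) dvd_rfl ?_ ?_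
  · intro h
    have := Nat.le_of_dvd (by positivity) h
    nlinarith [hp.two_le]
  · intro l hl _
    have := (Finset.mem_Icc.1 hl).2
    omega

theorem prime_lt_of_isSquare_prod {n k p : ℕ}
    (h : IsSquare (∏ k ∈ Finset.Icc 1 n, (k ^ 2 + 1))) (hn : 2 ≤ n) (hp : p.Prime)
    (hk : k ∈ Finset.Icc 1 n) (hpk : p ∣ k ^ 2 + 1) : p < 2 * n := by
  by_contra! hlt
  obtain ⟨h1, h2⟩ := Finset.mem_Icc.1 hk
  refine not_isSquare_prod_of_prime_dvd hp hk hpk (fun hd => ?_) (fun l hl hne => ?_) h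
  · have := Nat.le_of_dvd (by positivity) hd
    -- `p² ≥ 4n² > n² + 1 ≥ k² + 1`.
    nlinarith
  · have := (Finset.mem_Icc.1 hl).2
    omega

theorem not_isSquare_prod_of_le {n : ℕ} (h3 : 3 < n) (hn : n ≤ 10 ^ 40) :
    ¬ IsSquare (∏ k ∈ Finset.Icc 1 n, (k ^ 2 + 1)) := by
  -- A prime `k² + 1` settles `k ≤ n ≤ k² - k`. The chosen `k` give overlapping ranges, the last
  -- reaching beyond `10 ^ 40`; the large ones are of the form `2 ^ u * 5 ^ v` so that Lucas'
  -- criterion needs only two exponents.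
  rcases lt_or_ge n 13 with h | h
  · exact not_isSquare_prod_of_prime (k := 4) (by norm_num) (by norm_num) h3 (by omega)
  rcases lt_or_ge n 91 with h | h
  · exact not_isSquare_prod_of_prime (k := 10) (by norm_num) (by norm_num) (by omega) (by omega)
  rcases lt_or_ge n 1561 with h | h
  · exact not_isSquare_prod_of_prime (k := 40) (by norm_num) (by norm_num) (by omega) (by omega)
  rcases lt_or_ge n 159601 with h | h
  · exact not_isSquare_prod_of_prime (k := 400) (by norm_num) (by norm_num) (by omega) (by omega)
  rcases lt_or_ge n 16383872001 with h | h
  · exact not_isSquare_prod_of_prime (k := 128000)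
      (prime_sq_add_one (u := 10) (v := 3) 140 3 (by norm_num) (by norm_num) (by decide +kernel)
        (by decide +kernel) (by decide +kernel)) (by norm_num) (by omega) (by omega)
  rcases lt_or_ge n 255999999984000000001 with h | h
  · exact not_isSquare_prod_of_prime (k := 16000000000)
      (prime_sq_add_one (u := 13) (v := 9) 140 3 (by norm_num) (by norm_num) (by decide +kernel)
        (by decide +kernel) (by decide +kernel)) (by norm_num) (by omega) (by omega)
  · exact not_isSquare_prod_of_prime (k := 238418579101562500000)
      (prime_sq_add_one (u := 5) (v := 27) 140 3 (by norm_num) (by norm_num) (by decide +kernel)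
        (by decide +kernel) (by decide +kernel)) (by norm_num) (by omega) (by omega)

/-! ### Alternating sums with the character `χ₄` -/

open ArithmeticFunction Finset

/-- The alternating series estimate: the nonzero values of `χ₄` alternate in sign, and `a % 4`
decides the sign of the first. The induction peels off the first term, hence the general `a` and
`f`. -/
theorem sum_chi₄_mul_bounds (N : ℕ) : ∀ (a : ℕ) (f : ℕ → ℝ), Antitone f → (∀ i, 0 ≤ f i) →
    (a % 4 < 2 → 0 ≤ ∑ i ∈ range N, (ZMod.χ₄ (a + i : ℕ) : ℝ) * f i ∧
      ∑ i ∈ range N, (ZMod.χ₄ (a + i : ℕ) : ℝ) * f i ≤ f 0) ∧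
    (2 ≤ a % 4 → -f 0 ≤ ∑ i ∈ range N, (ZMod.χ₄ (a + i : ℕ) : ℝ) * f i ∧
      ∑ i ∈ range N, (ZMod.χ₄ (a + i : ℕ) : ℝ) * f i ≤ 0) := by
  induction N with
  | zero => intro a f _ hf; simp [hf 0]
  | succ N ih =>
    intro a f hf h0
    have hS : ∑ i ∈ range (N + 1), (ZMod.χ₄ (a + i : ℕ) : ℝ) * f i =
        (ZMod.χ₄ (a : ℕ) : ℝ) * f 0 +
          ∑ i ∈ range N, (ZMod.χ₄ (a + 1 + i : ℕ) : ℝ) * f (i + 1) := by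
      rw [sum_range_succ', add_comm, add_zero]
      simp only [add_assoc, add_comm 1]
    obtain ⟨i1, i2⟩ := ih (a + 1) (fun i => f (i + 1)) (fun i j h => hf (by omega)) (fun i => h0 _)
    have hf1 : f (0 + 1) ≤ f 0 := hf (by omega)
    have hlt := Nat.mod_lt a (by norm_num : 4 > 0)
    have hf0 := h0 0
    rw [hS, ZMod.χ₄_nat_eq_if_mod_four]
    interval_cases h : a % 4
    · obtain ⟨j1, j2⟩ := i1 (by omega)
      rw [if_pos (by omega)]
      simp only [Int.cast_zero, zero_mul, zero_add] at *
      exact ⟨fun _ => ⟨j1, j2.trans hf1⟩, fun h => by omega⟩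
    · obtain ⟨j1, j2⟩ := i2 (by omega)
      rw [if_neg (by omega), if_pos rfl]
      simp only [Int.cast_one, one_mul, zero_add] at *
      exact ⟨fun _ => ⟨by linarith, by linarith⟩, fun h => by omega⟩
    · obtain ⟨j1, j2⟩ := i2 (by omega)
      rw [if_pos (by omega)]
      simp only [Int.cast_zero, zero_mul, zero_add] at *
      exact ⟨fun h => by omega, fun _ => ⟨by linarith, by linarith⟩⟩
    · obtain ⟨j1, j2⟩ := i1 (by omega)
      rw [if_neg (by omega), if_neg (by omega)]
      simp only [Int.cast_neg, Int.cast_one, neg_mul, one_mul, zero_add] at *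
      exact ⟨fun h => by omega, fun _ => ⟨by linarith, by linarith⟩⟩

theorem sum_Ioc_chi₄_eq (f : ℕ → ℝ) {m n : ℕ} (h : m ≤ n) :
    ∑ k ∈ Ioc 0 n, (ZMod.χ₄ (k : ℕ) : ℝ) * f k =
      ∑ k ∈ Ioc 0 m, (ZMod.χ₄ (k : ℕ) : ℝ) * f k +
        ∑ i ∈ range (n - m), (ZMod.χ₄ (m + 1 + i : ℕ) : ℝ) * f (m + 1 + i) := by
  obtain ⟨t, rfl⟩ := Nat.exists_eq_add_of_le h
  rw [Nat.add_sub_cancel_left]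
  induction t with
  | zero => simp
  | succ t ih =>
    rw [← add_assoc, sum_Ioc_succ_top (by omega), ih (by omega), sum_range_succ, add_assoc,
      show m + 1 + t = m + t + 1 by omega]

/-- The partial sums of the Dirichlet series of `χ₄` at `1`. -/
noncomputable def chi₄PartialSum (n : ℕ) : ℝ := ∑ k ∈ Ioc 0 n, (ZMod.χ₄ (k : ℕ) : ℝ) * (k : ℝ)⁻¹

theorem antitone_inv_add (a : ℕ) (ha : 0 < a) : Antitone fun i : ℕ => ((a + i : ℕ) : ℝ)⁻¹ := by
  intro i j h
  have : (0 : ℝ) < (a + i : ℕ) := by exact_mod_cast (by omega)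
  exact inv_anti₀ this (by exact_mod_cast (by omega))

theorem two_thirds_le_chi₄PartialSum {n : ℕ} (hn : 2 ≤ n) : 2 / 3 ≤ chi₄PartialSum n := by
  rw [chi₄PartialSum, sum_Ioc_chi₄_eq _ hn]
  -- The head is `1`, and the tail starting at `-1/3` is at least `-1/3`.
  have h := ((sum_chi₄_mul_bounds (n - 2) 3 _ (antitone_inv_add 3 (by norm_num))
    (fun i => by positivity)).2 (by norm_num)).1
  have h2 : ∑ k ∈ Ioc 0 2, (ZMod.χ₄ (k : ℕ) : ℝ) * (k : ℝ)⁻¹ = 1 := by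
    rw [sum_Ioc_succ_top (by omega), sum_Ioc_succ_top (by omega)]
    simp
  rw [h2]
  norm_num at h ⊢
  linarith

theorem abs_chi₄PartialSum_sub_le {m n : ℕ} (h : m ≤ n) :
    |chi₄PartialSum n - chi₄PartialSum m| ≤ ((m + 1 : ℕ) : ℝ)⁻¹ := by
  rw [chi₄PartialSum, chi₄PartialSum, sum_Ioc_chi₄_eq _ h, add_sub_cancel_left]
  obtain ⟨h1, h2⟩ := sum_chi₄_mul_bounds (n - m) (m + 1) _ (antitone_inv_add (m + 1) (by omega))
    (fun i => by positivity)
  have hp : (0 : ℝ) ≤ ((m + 1 : ℕ) : ℝ)⁻¹ := by positivity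
  simp only [add_zero] at h1 h2
  rw [abs_le]
  rcases lt_or_ge ((m + 1) % 4) 2 with hm | hm
  · obtain ⟨h3, h4⟩ := h1 hm
    constructor <;> linarith
  · obtain ⟨h3, h4⟩ := h2 hm
    constructor <;> linarith

theorem sum_chi₄_mul_log_div_le {n : ℕ} (hn : 4 ≤ n) :
    ∑ k ∈ Ioc 0 n, (ZMod.χ₄ (k : ℕ) : ℝ) * (Real.log k / k) ≤ 1 := by
  -- `log x / x` decreases only from `e` on, so the first four terms are split off; they contribute
  -- `-log 3 / 3`.
  rw [sum_Ioc_chi₄_eq (fun k => Real.log k / k) hn]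
  have hanti : Antitone fun i : ℕ => Real.log (4 + 1 + i : ℕ) / (4 + 1 + i : ℕ) := by
    intro i j h
    have he := Real.exp_one_lt_d9
    have h5 (i : ℕ) : ((4 + 1 + i : ℕ) : ℝ) ∈ Set.Ici (Real.exp 1) := by
      rw [Set.mem_Ici]
      push_cast
      have : (0 : ℝ) ≤ i := by positivity
      linarith
    exact Real.log_div_self_antitoneOn (h5 i) (h5 j) (by exact_mod_cast (by omega))
  have h := ((sum_chi₄_mul_bounds (n - 4) (4 + 1) _ hanti (fun i => by positivity)).1
    (by norm_num)).2
  have h4 : ∑ k ∈ Ioc 0 4, (ZMod.χ₄ (k : ℕ) : ℝ) * (Real.log k / k) ≤ 0 := by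
    rw [sum_Ioc_succ_top (by omega), sum_Ioc_succ_top (by omega), sum_Ioc_succ_top (by omega),
      sum_Ioc_succ_top (by omega)]
    simp
    positivity
  have h5 : Real.log (4 + 1 + 0 : ℕ) / (4 + 1 + 0 : ℕ) ≤ 1 :=
    div_le_one_of_le₀ (Real.log_le_self (by positivity)) (by positivity)
  linarith

/-! ### Mertens-type estimates -/

theorem sum_Ioc_sum_divisors (n : ℕ) (F : ℕ → ℕ → ℝ) :
    ∑ m ∈ Ioc 0 n, ∑ d ∈ m.divisors, F d (m / d) =
      ∑ d ∈ Ioc 0 n, ∑ k ∈ Ioc 0 (n / d), F d k := by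
  rw [sum_sigma', sum_sigma']
  refine sum_bij' (fun x _ => ⟨x.2, x.1 / x.2⟩) (fun x _ => ⟨x.1 * x.2, x.1⟩) ?_ ?_ ?_ ?_ ?_
  · rintro ⟨m, d⟩ h
    simp only [mem_sigma, mem_Ioc, Nat.mem_divisors] at h ⊢
    obtain ⟨⟨h1, h2⟩, h3, h4⟩ := h
    have hd := Nat.pos_of_dvd_of_pos h3 h1
    have hle := Nat.le_of_dvd h1 h3
    exact ⟨⟨hd, hle.trans h2⟩, Nat.div_pos hle hd, Nat.div_le_div_right h2⟩
  · rintro ⟨d, k⟩ h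
    simp only [mem_sigma, mem_Ioc, Nat.mem_divisors] at h ⊢
    obtain ⟨⟨h1, h2⟩, h3, h4⟩ := h
    exact ⟨⟨by positivity, by rw [mul_comm]; exact (Nat.le_div_iff_mul_le h1).1 h4⟩,
      dvd_mul_right _ _, by positivity⟩
  · rintro ⟨m, d⟩ h
    simp only [mem_sigma, mem_Ioc, Nat.mem_divisors] at h
    simp [Nat.mul_div_cancel' h.2.1]
  · rintro ⟨d, k⟩ h
    simp only [mem_sigma, mem_Ioc] at h
    simp [Nat.mul_div_cancel_left _ h.1.1]
  · rintro ⟨m, d⟩ h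
    rfl

theorem sum_Ioc_log_eq (n : ℕ) :
    ∑ m ∈ Ioc 0 n, Real.log m = ∑ d ∈ Ioc 0 n, vonMangoldt d * (n / d : ℕ) := by
  have := sum_Ioc_sum_divisors n (fun d _ => vonMangoldt d)
  simpa [vonMangoldt_sum, mul_comm] using this

theorem psi_natCast (n : ℕ) : Chebyshev.psi n = ∑ d ∈ Ioc 0 n, vonMangoldt d := by
  rw [Chebyshev.psi, Nat.floor_natCast]

theorem sum_vonMangoldt_div_le (n : ℕ) :
    n * ∑ d ∈ Ioc 0 n, vonMangoldt d / d ≤ n * Real.log n + Chebyshev.psi n := by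
  have h1 : ∑ m ∈ Ioc 0 n, Real.log m ≤ n * Real.log n := by
    calc _ ≤ ∑ m ∈ Ioc 0 n, Real.log n := sum_le_sum fun m hm => by
          obtain ⟨h1, h2⟩ := mem_Ioc.1 hm
          exact Real.log_le_log (by exact_mod_cast h1) (by exact_mod_cast h2)
      _ = _ := by simp
  rw [sum_Ioc_log_eq] at h1
  rw [psi_natCast, mul_sum]
  have h2 : ∑ d ∈ Ioc 0 n, (n : ℝ) * (vonMangoldt d / d) ≤
      ∑ d ∈ Ioc 0 n, (vonMangoldt d * (n / d : ℕ) + vonMangoldt d) := sum_le_sum fun d hd => by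
    have h := (Nat.lt_floor_add_one ((n : ℝ) / d)).le
    rw [Nat.floor_div_eq_div] at h
    calc (n : ℝ) * (vonMangoldt d / d) = vonMangoldt d * (n / d) := by ring
      _ ≤ vonMangoldt d * ((n / d : ℕ) + 1) := mul_le_mul_of_nonneg_left h vonMangoldt_nonneg
      _ = _ := by ring
  rw [sum_add_distrib] at h2
  linarith

/-- From `log = Λ * 1`, the sum of `χ₄(k) log k / k` is that of `χ₄(d)Λ(d)/d · L(n/d)`, with `L` =
`chi₄PartialSum`. Replacing `L(n/d)` by `L(n)` costs at most `d/n` per factor, in total `ψ(n)/n`;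
then divide by `L(n) ≥ 2/3`. -/
theorem sum_chi₄_mul_vonMangoldt_div_le {n : ℕ} (hn : 4 ≤ n) :
    n * ∑ d ∈ Ioc 0 n, (ZMod.χ₄ (d : ℕ) : ℝ) * vonMangoldt d / d ≤
      3 / 2 * (n + Chebyshev.psi n) := by
  set T := ∑ d ∈ Ioc 0 n, (ZMod.χ₄ (d : ℕ) : ℝ) * vonMangoldt d / d with hT
  have hn0 : (0 : ℝ) < n := by exact_mod_cast (by omega)
  have hS : ∑ k ∈ Ioc 0 n, (ZMod.χ₄ (k : ℕ) : ℝ) * (Real.log k / k) =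
      ∑ d ∈ Ioc 0 n, (ZMod.χ₄ (d : ℕ) : ℝ) * vonMangoldt d / d * chi₄PartialSum (n / d) := by
    simp only [chi₄PartialSum, mul_sum]
    rw [← sum_Ioc_sum_divisors n (fun d k => (ZMod.χ₄ (d : ℕ) : ℝ) * vonMangoldt d / d *
      ((ZMod.χ₄ (k : ℕ) : ℝ) * (k : ℝ)⁻¹))]
    refine sum_congr rfl fun m hm => ?_
    rw [← vonMangoldt_sum, sum_div, mul_sum]
    refine sum_congr rfl fun d hd => ?_
    obtain ⟨e, rfl⟩ := (Nat.mem_divisors.1 hd).1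
    have hd0 : 0 < d := Nat.pos_of_mul_pos_right (mem_Ioc.1 hm).1
    rw [Nat.mul_div_cancel_left _ hd0]
    push_cast
    rw [map_mul]
    push_cast
    rw [div_eq_mul_inv, div_eq_mul_inv, mul_inv]
    ring
  have hdiff : chi₄PartialSum n * T - ∑ k ∈ Ioc 0 n, (ZMod.χ₄ (k : ℕ) : ℝ) * (Real.log k / k) ≤
      Chebyshev.psi n / n := by
    rw [hS, hT, mul_sum, ← sum_sub_distrib, psi_natCast, sum_div]
    refine sum_le_sum fun d hd => ?_
    obtain ⟨h1, h2⟩ := mem_Ioc.1 hd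
    have hd0 : (0 : ℝ) < d := by exact_mod_cast h1
    have hΛ : 0 ≤ vonMangoldt d / d := div_nonneg vonMangoldt_nonneg hd0.le
    have hχ : |(ZMod.χ₄ (d : ℕ) : ℝ)| ≤ 1 := by
      rw [ZMod.χ₄_nat_eq_if_mod_four]
      split_ifs <;> simp
    have hb := abs_chi₄PartialSum_sub_le (Nat.div_le_self n d)
    have hlt : ((n / d + 1 : ℕ) : ℝ)⁻¹ ≤ d / n := by
      rw [inv_le_comm₀ (by positivity) (by positivity), inv_div]
      have h := (Nat.lt_floor_add_one ((n : ℝ) / d)).le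
      rw [Nat.floor_div_eq_div] at h
      exact_mod_cast h
    calc chi₄PartialSum n * ((ZMod.χ₄ (d : ℕ) : ℝ) * vonMangoldt d / d) -
          (ZMod.χ₄ (d : ℕ) : ℝ) * vonMangoldt d / d * chi₄PartialSum (n / d)
        = (ZMod.χ₄ (d : ℕ) : ℝ) * (vonMangoldt d / d) *
          (chi₄PartialSum n - chi₄PartialSum (n / d)) := by ring
      _ ≤ |(ZMod.χ₄ (d : ℕ) : ℝ) * (vonMangoldt d / d) *
          (chi₄PartialSum n - chi₄PartialSum (n / d))| := le_abs_self _
      _ = |(ZMod.χ₄ (d : ℕ) : ℝ)| * (vonMangoldt d / d) *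
          |chi₄PartialSum n - chi₄PartialSum (n / d)| := by
          rw [abs_mul, abs_mul, abs_of_nonneg hΛ]
      _ ≤ 1 * (vonMangoldt d / d) * (d / n) := by gcongr; exact hb.trans hlt
      _ = vonMangoldt d / n := by field_simp
  have hS1 := sum_chi₄_mul_log_div_le hn
  have hL := two_thirds_le_chi₄PartialSum (n := n) (by omega)
  have hψ := Chebyshev.psi_nonneg n
  rcases le_or_gt T 0 with h | h
  · have : (n : ℝ) * T ≤ 0 := mul_nonpos_of_nonneg_of_nonpos hn0.le h
    linarith
  · have h1 : 2 / 3 * T ≤ 1 + Chebyshev.psi n / n := by nlinarith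
    have h2 := mul_le_mul_of_nonneg_left h1 hn0.le
    rw [mul_add, mul_div_cancel₀ _ hn0.ne'] at h2
    linarith

/-! ### Counting solutions of `k² ≡ -1` modulo prime powers -/

theorem card_filter_modEq_le (d a n : ℕ) :
    #{k ∈ Icc 1 n | k ≡ a [MOD d]} ≤ n / d + 1 := by
  rw [← card_range (n / d + 1)]
  refine card_le_card_of_injOn (fun k => k / d) (fun k hk => ?_) (fun k hk l hl h => ?_)
  · simp only [coe_filter, mem_Icc, Set.mem_ofPred_eq, coe_range, Set.mem_Iio] at hk ⊢
    exact Nat.lt_succ_of_le (Nat.div_le_div_right hk.1.2)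
  · simp only [coe_filter, mem_Icc, Set.mem_ofPred_eq] at hk hl h
    have hm : k % d = l % d := hk.2.trans hl.2.symm
    rw [← Nat.div_add_mod k d, ← Nat.div_add_mod l d, h, hm]

theorem card_roots_le_two_mul {p j : ℕ} (hp : p.Prime) (hp2 : p ≠ 2) (n : ℕ) :
    #{k ∈ Icc 1 n | p ^ j ∣ k ^ 2 + 1} ≤ 2 * (n / p ^ j + 1) := by
  rcases Nat.eq_zero_or_pos j with rfl | hj
  · refine (card_filter_le _ _).trans ?_
    simp
    omega
  rcases eq_empty_or_nonempty {k ∈ Icc 1 n | p ^ j ∣ k ^ 2 + 1} with he | ⟨l, hl⟩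
  · simp [he]
  obtain ⟨hl1, hl2⟩ := mem_filter.1 hl
  have hZ : (l : ZMod (p ^ j)) ^ 2 + 1 = 0 := by
    have := (ZMod.natCast_eq_zero_iff _ _).2 hl2
    exact_mod_cast this
  have hsub : {k ∈ Icc 1 n | p ^ j ∣ k ^ 2 + 1} ⊆
      {k ∈ Icc 1 n | k ≡ l [MOD p ^ j]} ∪
        {k ∈ Icc 1 n | k ≡ (-(l : ZMod (p ^ j))).val [MOD p ^ j]} := by
    intro k hk
    obtain ⟨hk1, hk2⟩ := mem_filter.1 hk
    have : NeZero (p ^ j) := ⟨by have := hp.pos; positivity⟩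
    rw [mem_union, mem_filter, mem_filter, ← ZMod.natCast_eq_natCast_iff,
      ← ZMod.natCast_eq_natCast_iff, ZMod.natCast_zmod_val]
    have hd : ((p : ℤ) ^ j) ∣ ((k : ℤ) - l) * (k + l) := by
      have e : ((k : ℤ) - l) * (k + l) = (k ^ 2 + 1 : ℕ) - (l ^ 2 + 1 : ℕ) := by
        push_cast
        ring
      rw [e]
      exact_mod_cast dvd_sub (Int.natCast_dvd_natCast.2 hk2) (Int.natCast_dvd_natCast.2 hl2)
    have hpZ := Nat.prime_iff_prime_int.1 hp
    -- Since `p` cannot divide both factors, all of `p ^ j` divides one of them, so `k ≡ ± l`.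
    have hnot : ¬ ((p : ℤ) ∣ k - l ∧ (p : ℤ) ∣ k + l) := by
      rintro ⟨h1, h2⟩
      have h3 : (p : ℤ) ∣ 2 * k := by
        have := dvd_add h1 h2
        rwa [show (k : ℤ) - l + (k + l) = 2 * k by ring] at this
      rcases hpZ.dvd_or_dvd h3 with h | h
      · exact hp2 ((Nat.prime_dvd_prime_iff_eq hp Nat.prime_two).1 (by exact_mod_cast h))
      · have h4 : p ∣ k := by exact_mod_cast h
        have h5 : p ∣ k ^ 2 + 1 := (dvd_pow_self p hj.ne').trans hk2
        exact hp.one_lt.ne' (Nat.dvd_one.1 ((Nat.dvd_add_right (h4.pow (by norm_num))).1 h5))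
    by_cases h1 : (p : ℤ) ∣ k - l
    · have h2 : IsCoprime ((p : ℤ) ^ j) (k + l) :=
        ((Prime.coprime_iff_not_dvd hpZ).2 fun h => hnot ⟨h1, h⟩).pow_left
      left
      refine ⟨hk1, ?_⟩
      have h3 := h2.dvd_of_dvd_mul_right hd
      have h4 := (ZMod.intCast_zmod_eq_zero_iff_dvd (k - l) (p ^ j)).2 (by exact_mod_cast h3)
      push_cast at h4
      exact sub_eq_zero.1 h4
    · have h2 : IsCoprime ((p : ℤ) ^ j) (k - l) :=
        ((Prime.coprime_iff_not_dvd hpZ).2 h1).pow_left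
      right
      refine ⟨hk1, ?_⟩
      have h3 := h2.dvd_of_dvd_mul_left hd
      have h4 := (ZMod.intCast_zmod_eq_zero_iff_dvd (k + l) (p ^ j)).2 (by exact_mod_cast h3)
      push_cast at h4
      exact eq_neg_of_add_eq_zero_left h4
  calc _ ≤ _ := card_le_card hsub
    _ ≤ _ := card_union_le _ _
    _ ≤ (n / p ^ j + 1) + (n / p ^ j + 1) :=
      add_le_add (card_filter_modEq_le _ _ _) (card_filter_modEq_le _ _ _)
    _ = _ := by ring

theorem not_dvd_sq_add_one_of_mod_four {p j k : ℕ} (hp : p.Prime) (hd : p ^ j % 4 = 3) :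
    ¬ p ^ j ∣ k ^ 2 + 1 := by
  intro h
  have hj : j ≠ 0 := by
    rintro rfl
    norm_num at hd
  have hsq : IsSquare (-1 : ZMod (k ^ 2 + 1)) := by
    refine ⟨k, ?_⟩
    have : ((k ^ 2 + 1 : ℕ) : ZMod (k ^ 2 + 1)) = 0 := ZMod.natCast_self _
    push_cast at this
    linear_combination -this
  have h3 : p % 4 ≠ 3 := Nat.mod_four_ne_three_of_mem_primeFactors_of_isSquare_neg_one
    (Nat.mem_primeFactors.2 ⟨hp, (dvd_pow_self p hj).trans h, by positivity⟩) hsq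
  have hlt := Nat.mod_lt p (by norm_num : 4 > 0)
  rw [Nat.pow_mod] at hd
  interval_cases p % 4
  · simp [hj] at hd
  · simp at hd
  · have := Nat.mod_eq_zero_of_dvd (dvd_pow_self 2 hj)
    omega
  · exact h3 rfl

/-- `1 + χ₄(d)` bounds the number of residue classes: one for powers of `2` (none beyond `2`
itself), two for `d ≡ 1`, none for `d ≡ 3` mod `4`. -/
theorem card_roots_le {d : ℕ} (hd : IsPrimePow d) (n : ℕ) :
    (#{k ∈ Icc 1 n | d ∣ k ^ 2 + 1} : ℝ) ≤
      (1 + (ZMod.χ₄ (d : ℕ) : ℝ)) * ((n / d : ℕ) + 1) := by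
  obtain ⟨p, j, hp, hj, rfl⟩ := (isPrimePow_nat_iff _).1 hd
  rw [ZMod.χ₄_nat_eq_if_mod_four]
  by_cases hp2 : p = 2
  · subst hp2
    rw [if_pos (Nat.mod_eq_zero_of_dvd (dvd_pow_self 2 hj.ne'))]
    have hle : #{k ∈ Icc 1 n | 2 ^ j ∣ k ^ 2 + 1} ≤ n / 2 ^ j + 1 := by
      refine le_trans (card_le_card ?_) (card_filter_modEq_le (2 ^ j) 1 n)
      intro k hk
      rw [mem_filter] at hk ⊢
      refine ⟨hk.1, ?_⟩
      have hj1 : j = 1 := by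
        by_contra hne
        have h4 : 2 ^ 2 ∣ k ^ 2 + 1 := (pow_dvd_pow 2 (by omega)).trans hk.2
        have := Nat.mod_eq_zero_of_dvd h4
        rcases Nat.even_or_odd' k with ⟨c, rfl | rfl⟩ <;> ring_nf at this <;> omega
      subst hj1
      have h2 := Nat.mod_eq_zero_of_dvd hk.2
      rcases Nat.even_or_odd' k with ⟨c, rfl | rfl⟩
      · ring_nf at h2
        omega
      · rw [Nat.ModEq]
        omega
    simpa using (by exact_mod_cast hle : (#{k ∈ Icc 1 n | 2 ^ j ∣ k ^ 2 + 1} : ℝ) ≤ _)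
  have hodd : (p ^ j) % 2 = 1 := Nat.odd_iff.1 ((hp.odd_of_ne_two hp2).pow)
  rw [if_neg (by omega)]
  split_ifs with h1
  · have := card_roots_le_two_mul (j := j) hp hp2 n
    have : (#{k ∈ Icc 1 n | p ^ j ∣ k ^ 2 + 1} : ℝ) ≤ (2 * (n / p ^ j + 1) : ℕ) := by
      exact_mod_cast this
    push_cast at this ⊢
    linarith
  · have : {k ∈ Icc 1 n | p ^ j ∣ k ^ 2 + 1} = ∅ :=
      filter_eq_empty_iff.2 fun k _ => not_dvd_sq_add_one_of_mod_four hp (by omega)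
    simp [this]

/-! ### Upper and lower bounds for the logarithm of the product -/

/-- The powers of `p` up to `N` contribute `⌊log_p N⌋ · log p ≤ log N`. -/
theorem sum_vonMangoldt_le_primeCounting_mul_log {N y : ℕ} (D : Finset ℕ)
    (hN : ∀ d ∈ D, d ≤ N) (hy : ∀ d ∈ D, ∀ p : ℕ, p.Prime → p ∣ d → p ≤ y) :
    ∑ d ∈ D, vonMangoldt d ≤ y.primeCounting * Real.log N := by
  have hfib (p : ℕ) (hp : p.Prime) :
      ∑ d ∈ D with IsPrimePow d ∧ d.minFac = p, vonMangoldt d ≤ Real.log N := by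
    rcases Nat.eq_zero_or_pos N with rfl | hN0
    · refine le_of_eq_of_le (sum_eq_zero fun d hd => ?_) (by simp)
      have := hN d (mem_filter.1 hd).1
      simp [Nat.le_zero.1 this]
    have hsub : {d ∈ D | IsPrimePow d ∧ d.minFac = p} ⊆ (Icc 1 (Nat.log p N)).image (p ^ ·) := by
      intro d hd
      obtain ⟨h1, h2, h3⟩ := mem_filter.1 hd
      obtain ⟨q, j, hq, hj, rfl⟩ := (isPrimePow_nat_iff _).1 h2
      rw [hq.pow_minFac hj.ne'] at h3
      subst h3
      exact mem_image.2 ⟨j, mem_Icc.2 ⟨hj, Nat.le_log_of_pow_le hp.one_lt (hN _ h1)⟩, rfl⟩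
    calc _ ≤ ∑ d ∈ (Icc 1 (Nat.log p N)).image (p ^ ·), vonMangoldt d :=
          sum_le_sum_of_subset_of_nonneg hsub fun _ _ _ => vonMangoldt_nonneg
      _ = ∑ j ∈ Icc 1 (Nat.log p N), vonMangoldt (p ^ j) :=
          sum_image fun i _ j _ h => Nat.pow_right_injective hp.two_le h
      _ = ∑ j ∈ Icc 1 (Nat.log p N), Real.log p := sum_congr rfl fun j hj => by
          rw [vonMangoldt_apply_pow (by have := (mem_Icc.1 hj).1; omega),
            vonMangoldt_apply_prime hp]
      _ = Real.log ((p ^ Nat.log p N : ℕ) : ℝ) := by simp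
      _ ≤ Real.log N := Real.log_le_log (by have := hp.pos; positivity)
          (by exact_mod_cast Nat.pow_log_le_self p hN0.ne')
  calc ∑ d ∈ D, vonMangoldt d = ∑ d ∈ D with IsPrimePow d, vonMangoldt d := by
        rw [sum_filter_of_ne]
        exact fun d _ h => vonMangoldt_ne_zero_iff.1 h
    _ = ∑ p ∈ Nat.primesLE y, ∑ d ∈ D with IsPrimePow d ∧ d.minFac = p, vonMangoldt d := by
        rw [← sum_fiberwise_of_maps_to (g := Nat.minFac) (t := Nat.primesLE y)]
        · simp only [filter_filter]
        · intro d hd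
          obtain ⟨h1, h2⟩ := mem_filter.1 hd
          have hp := Nat.minFac_prime h2.ne_one
          exact Nat.mem_primesLE.2 ⟨hy d h1 _ hp (Nat.minFac_dvd d), hp⟩
    _ ≤ ∑ p ∈ Nat.primesLE y, Real.log N :=
        sum_le_sum fun p hp => hfib p (Nat.mem_primesLE.1 hp).2
    _ = _ := by rw [sum_const, nsmul_eq_mul, Nat.primesLE_card_eq_primeCounting]

theorem log_prod_sq_add_one_le {n : ℕ} (hn : 4 ≤ n)
    (h : IsSquare (∏ k ∈ Icc 1 n, (k ^ 2 + 1))) :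
    Real.log (∏ k ∈ Icc 1 n, (k ^ 2 + 1) : ℕ) ≤
      n * Real.log n + Chebyshev.psi n + 3 / 2 * (n + Chebyshev.psi n) +
        4 * ((2 * n).primeCounting * Real.log (n ^ 2 + 1 : ℕ)) := by
  classical
  set D := {d ∈ Ioc 0 (n ^ 2 + 1) | ∀ p : ℕ, p.Prime → p ∣ d → p ≤ 2 * n} with hD
  have hmem (k : ℕ) (hk : k ∈ Icc 1 n) : (k ^ 2 + 1).divisors = {d ∈ D | d ∣ k ^ 2 + 1} := by
    ext d
    simp only [hD, Nat.mem_divisors, mem_filter, mem_Ioc]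
    refine ⟨fun hd => ⟨⟨⟨Nat.pos_of_dvd_of_pos hd.1 (by positivity), ?_⟩, fun p hp hpd =>
      (prime_lt_of_isSquare_prod h (by omega) hp hk (hpd.trans hd.1)).le⟩, hd.1⟩,
      fun hd => ⟨hd.2, by positivity⟩⟩
    have h1 := Nat.le_of_dvd (by positivity) hd.1
    have h2 := Nat.pow_le_pow_left (mem_Icc.1 hk).2 2
    omega
  have hlog : Real.log (∏ k ∈ Icc 1 n, (k ^ 2 + 1) : ℕ) =
      ∑ d ∈ D, vonMangoldt d * #{k ∈ Icc 1 n | d ∣ k ^ 2 + 1} := by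
    rw [Nat.cast_prod, Real.log_prod (fun k _ => by positivity)]
    calc _ = ∑ k ∈ Icc 1 n, ∑ d ∈ D with d ∣ k ^ 2 + 1, vonMangoldt d :=
          sum_congr rfl fun k hk => by rw [← hmem k hk, vonMangoldt_sum]
      _ = ∑ d ∈ D, ∑ k ∈ Icc 1 n with d ∣ k ^ 2 + 1, vonMangoldt d := by
          simp only [sum_filter]
          rw [sum_comm]
      _ = _ := sum_congr rfl fun d _ => by rw [sum_const, nsmul_eq_mul, mul_comm]
  have hχ (d : ℕ) : 0 ≤ 1 + (ZMod.χ₄ (d : ℕ) : ℝ) ∧ 1 + (ZMod.χ₄ (d : ℕ) : ℝ) ≤ 2 := by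
    rw [ZMod.χ₄_nat_eq_if_mod_four]
    split_ifs <;> norm_num
  -- The floor `n / d` vanishes for `d > n`, leaving only the `+ 1` term; its constant `4` is
  -- generous, as `1 + χ₄ ≤ 2`.
  have hterm (d : ℕ) (hd : d ∈ D) : vonMangoldt d * #{k ∈ Icc 1 n | d ∣ k ^ 2 + 1} ≤
      (if d ≤ n then n * ((1 + (ZMod.χ₄ (d : ℕ) : ℝ)) * vonMangoldt d / d) else 0) +
        4 * vonMangoldt d := by
    have hΛ := vonMangoldt_nonneg (n := d)
    by_cases hpp : IsPrimePow d
    · have hc := mul_le_mul_of_nonneg_left (card_roots_le hpp n) hΛ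
      obtain ⟨h1, h2⟩ := hχ d
      refine hc.trans ?_
      split_ifs with hdn
      · have hfl : ((n / d : ℕ) : ℝ) ≤ n / d := Nat.cast_div_le
        have h3 := mul_le_mul_of_nonneg_left hfl (mul_nonneg hΛ h1)
        have h4 := mul_le_mul_of_nonneg_left h2 hΛ
        have e : (n : ℝ) * ((1 + (ZMod.χ₄ (d : ℕ) : ℝ)) * vonMangoldt d / d) =
          vonMangoldt d * (1 + (ZMod.χ₄ (d : ℕ) : ℝ)) * (n / d) := by ring
        rw [e]
        linarith
      · rw [Nat.div_eq_of_lt (by omega), Nat.cast_zero]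
        have h4 := mul_le_mul_of_nonneg_left h2 hΛ
        linarith
    · rw [vonMangoldt_eq_zero_iff.2 hpp]
      simp
  have hsum : ∑ d ∈ D, (if d ≤ n then
      (n : ℝ) * ((1 + (ZMod.χ₄ (d : ℕ) : ℝ)) * vonMangoldt d / d) else 0) ≤
      ∑ d ∈ Ioc 0 n, (n : ℝ) * ((1 + (ZMod.χ₄ (d : ℕ) : ℝ)) * vonMangoldt d / d) := by
    rw [← sum_filter]
    refine sum_le_sum_of_subset_of_nonneg (fun d hd => ?_) (fun d _ _ => ?_)
    · simp only [hD, mem_filter, mem_Ioc] at hd ⊢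
      exact ⟨hd.1.1.1, hd.2⟩
    · have := mul_nonneg (hχ d).1 (vonMangoldt_nonneg (n := d))
      positivity
  have hsplit : ∑ d ∈ Ioc 0 n, (n : ℝ) * ((1 + (ZMod.χ₄ (d : ℕ) : ℝ)) * vonMangoldt d / d) =
      n * ∑ d ∈ Ioc 0 n, vonMangoldt d / d +
        n * ∑ d ∈ Ioc 0 n, (ZMod.χ₄ (d : ℕ) : ℝ) * vonMangoldt d / d := by
    rw [mul_sum, mul_sum, ← sum_add_distrib]
    exact sum_congr rfl fun d _ => by ring
  have hΛD : ∑ d ∈ D, vonMangoldt d ≤ (2 * n).primeCounting * Real.log (n ^ 2 + 1 : ℕ) :=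
    sum_vonMangoldt_le_primeCounting_mul_log D (fun d hd => (mem_Ioc.1 (mem_filter.1 hd).1).2)
      (fun d hd => (mem_filter.1 hd).2)
  have hall := sum_le_sum hterm
  rw [sum_add_distrib, ← mul_sum] at hall
  have hM := sum_vonMangoldt_div_le n
  have hT := sum_chi₄_mul_vonMangoldt_div_le hn
  rw [hlog]
  linarith

theorem le_log_prod_sq_add_one {n : ℕ} (hn : 0 < n) :
    2 * (n * Real.log n - n) ≤ Real.log (∏ k ∈ Icc 1 n, (k ^ 2 + 1) : ℕ) := by
  have h1 : n.factorial ^ 2 ≤ ∏ k ∈ Icc 1 n, (k ^ 2 + 1) := by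
    clear hn
    induction n with
    | zero => simp
    | succ n ih =>
      rw [prod_Icc_succ_top (by omega), Nat.factorial_succ, mul_pow, mul_comm]
      exact Nat.mul_le_mul ih (Nat.le_succ _)
  have h2 := Real.pow_div_factorial_le_exp n (by positivity) n
  have hn0 : (0 : ℝ) < n := by exact_mod_cast hn
  have hf : (0 : ℝ) < n.factorial := by exact_mod_cast n.factorial_pos
  have h3 := Real.log_le_log (by positivity) h2
  rw [Real.log_exp, Real.log_div (by positivity) hf.ne', Real.log_pow] at h3
  have h4 : Real.log ((n.factorial ^ 2 : ℕ) : ℝ) ≤ Real.log (∏ k ∈ Icc 1 n, (k ^ 2 + 1) : ℕ) :=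
    Real.log_le_log (by positivity) (by exact_mod_cast h1)
  rw [Nat.cast_pow, Real.log_pow] at h4
  push_cast at h4
  push_cast
  linarith

/-! ### Numerical comparison for large `n` -/

theorem primeCounting_two_mul_le {n : ℕ} (hn : 2 ≤ n) :
    ((2 * n).primeCounting : ℝ) ≤ 4 * Real.log 4 * n / Real.log n + √(2 * n) := by
  have hn0 : (2 : ℝ) ≤ n := by exact_mod_cast hn
  have h := Chebyshev.pi_le_log4_mul_div (x := ((2 * n : ℕ) : ℝ)) (by push_cast; linarith)
  rw [Nat.floor_natCast] at h
  push_cast at h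
  refine h.trans (add_le_add_left ?_ _)
  rw [Real.log_sqrt (by positivity)]
  have hl : 0 < Real.log n := Real.log_pos (by linarith)
  have hl2 : Real.log n ≤ Real.log (2 * n) := Real.log_le_log (by positivity) (by linarith)
  have h4 : 0 ≤ Real.log 4 := Real.log_nonneg (by norm_num)
  calc Real.log 4 * (2 * n) / (Real.log (2 * n) / 2)
      ≤ Real.log 4 * (2 * n) / (Real.log n / 2) := by gcongr
    _ = _ := by field_simp; ring

theorem log_four_lt : Real.log 4 < 1.3863 := by
  rw [show (4 : ℝ) = 2 ^ 2 by norm_num, Real.log_pow]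
  have := Real.log_two_lt_d9
  norm_num at this ⊢
  linarith

theorem sqrt_two_mul_mul_log_le {x : ℝ} (hx0 : 0 < x) (hx : 90 ≤ Real.log x) :
    4 * √(2 * x) * (3 * Real.log x) ≤ x := by
  set L := Real.log x with hL
  have h1 : √(2 * x) ≤ 1.5 * √x := by
    rw [Real.sqrt_mul (by norm_num)]
    gcongr
    rw [Real.sqrt_le_left (by norm_num)]
    norm_num
  have h2 : 18 * L ≤ √x := by
    have h3 : √x = Real.exp (L / 2) := by
      rw [Real.exp_half, hL, Real.exp_log hx0]
    rw [h3]
    -- `exp (L / 2) ≥ L³ / 48`, which exceeds `18 L` once `L² ≥ 864`.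
    refine le_trans ?_ (Real.pow_div_factorial_le_exp (L / 2) (by linarith) 3)
    have h4 : 90 ^ 2 ≤ L ^ 2 := pow_le_pow_left₀ (by norm_num) hx 2
    norm_num [Nat.factorial]
    nlinarith
  calc 4 * √(2 * x) * (3 * L) ≤ 4 * (1.5 * √x) * (3 * L) := by gcongr
    _ = √x * (18 * L) := by ring
    _ ≤ √x * √x := by gcongr
    _ = x := Real.mul_self_sqrt hx0.le

theorem not_isSquare_prod_of_log_ge {n : ℕ} (hn : 90 ≤ Real.log n) :
    ¬ IsSquare (∏ k ∈ Icc 1 n, (k ^ 2 + 1)) := by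
  intro h
  have hn4 : 4 ≤ n := by
    by_contra! hlt
    have h1 : (n : ℝ) < 4 := by exact_mod_cast hlt
    have := Real.log_le_self (Nat.cast_nonneg (α := ℝ) n)
    linarith
  have hn0 : (4 : ℝ) ≤ n := by exact_mod_cast hn4
  have hupper := log_prod_sq_add_one_le hn4 h
  have hlower := le_log_prod_sq_add_one (n := n) (by omega)
  have hψ := Chebyshev.psi_le_const_mul_self (x := (n : ℝ)) (by positivity)
  have hπ := primeCounting_two_mul_le (n := n) (by omega)
  have h4 := log_four_lt
  set L := Real.log n with hL
  have hlog : Real.log (n ^ 2 + 1 : ℕ) ≤ 2 * L + 0.7 := by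
    have h1 : Real.log (n ^ 2 + 1 : ℕ) ≤ Real.log (2 * (n : ℝ) ^ 2) :=
      Real.log_le_log (by positivity) (by push_cast; nlinarith)
    rw [Real.log_mul (by norm_num) (by positivity), Real.log_pow] at h1
    have := Real.log_two_lt_d9
    push_cast at h1 ⊢
    linarith
  have hψ' : Chebyshev.psi n ≤ 5.4 * n := hψ.trans (by gcongr; linarith)
  have hsq : 4 * √(2 * n) * (3 * L) ≤ n := sqrt_two_mul_mul_log_le (by linarith) hn
  have hA : 4 * Real.log 4 * n / L ≤ 5.5452 * n / L := by gcongr; linarith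
  have hprod : 4 * ((2 * n).primeCounting * Real.log (n ^ 2 + 1 : ℕ)) ≤ 46 * n := by
    calc 4 * ((2 * n).primeCounting * Real.log (n ^ 2 + 1 : ℕ))
        ≤ 4 * ((5.5452 * n / L + √(2 * n)) * (2 * L + 0.7)) := by
          have : 0 ≤ Real.log (n ^ 2 + 1 : ℕ) := Real.log_natCast_nonneg _
          gcongr
          linarith
      _ = 44.3616 * n + 15.52656 * n / L + 4 * √(2 * n) * (2 * L + 0.7) := by
          field_simp
          ring
      _ ≤ 44.3616 * n + 0.2 * n + 4 * √(2 * n) * (3 * L) := by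
          have : 15.52656 * n / L ≤ 0.2 * n := by
            rw [div_le_iff₀ (by linarith)]
            nlinarith
          gcongr
          linarith
      _ ≤ 46 * n := by linarith
  -- The bounds combine to `2nL - 2n ≤ nL + 61n`, so `L ≤ 63`.
  nlinarith

theorem not_isSquare_prod_sq_add_one {n : ℕ} (hn : 3 < n) :
    ¬ IsSquare (∏ k ∈ Icc 1 n, (k ^ 2 + 1)) := by
  rcases le_or_gt n (10 ^ 40) with h | h
  · exact not_isSquare_prod_of_le hn h
  · refine not_isSquare_prod_of_log_ge ?_
    have h1 : ((10 : ℝ) ^ 40) < n := by exact_mod_cast h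
    -- The two ranges meet because `log (10 ^ 40) ≈ 92.1`.
    rw [Real.le_log_iff_exp_le (by linarith [show (0 : ℝ) < 10 ^ 40 by norm_num])]
    refine le_trans ?_ h1.le
    rw [show (90 : ℝ) = (90 : ℕ) * 1 by norm_num, Real.exp_nat_mul]
    calc Real.exp 1 ^ 90 ≤ 2.7182818286 ^ 90 := by gcongr; exact Real.exp_one_lt_d9.le
      _ ≤ 10 ^ 40 := by norm_num

/-! ### Gaussian integers and the conclusion -/

theorem prod_add_I_normSq (n : ℕ) :
    Complex.normSq (∏ k ∈ Icc 1 n, ((k : ℂ) + Complex.I)) =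
      (∏ k ∈ Icc 1 n, (k ^ 2 + 1) : ℕ) := by
  rw [map_prod, Nat.cast_prod]
  refine prod_congr rfl fun k _ => ?_
  simp [Complex.normSq_apply]
  ring

theorem exists_int_im_prod_add_I (n : ℕ) :
    ∃ a b : ℤ, ∏ k ∈ Icc 1 n, ((k : ℂ) + Complex.I) = a + b * Complex.I := by
  induction n with
  | zero => exact ⟨1, 0, by simp⟩
  | succ n ih =>
    obtain ⟨a, b, h⟩ := ih
    refine ⟨a * (n + 1) - b, a + b * (n + 1), ?_⟩
    rw [prod_Icc_succ_top (by omega), h]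
    push_cast
    linear_combination b * Complex.I_sq

theorem theorem2 :
    (∀ n : ℕ, 3 < n → ¬ IsSquare (∏ k ∈ Finset.Icc 1 n, (k ^ 2 + 1))) ∧
    (∀ b n : ℕ, 0 < b → 0 < n →
      (∏ k ∈ Finset.Icc 1 n, (k ^ 2 + 1) = b ^ 2 ↔ b = 10 ∧ n = 3)) ∧
    (∀ n : ℕ, 0 < n →
      ((∏ k ∈ Finset.Icc 1 n, ((k : ℂ) + Complex.I)).re = 0 ↔ n = 3)) := by
  refine ⟨fun n hn => not_isSquare_prod_sq_add_one hn, fun b n _ hn => ⟨fun h => ?_, ?_⟩,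
    fun n hn => ⟨fun h => ?_, ?_⟩⟩
  · have hn3 : n ≤ 3 := by
      by_contra! h3
      exact not_isSquare_prod_sq_add_one h3 ⟨b, by rw [h, pow_two]⟩
    have hb : b ≤ 10 := by
      have : b ^ 2 ≤ 10 ^ 2 := by
        rw [← h]
        interval_cases n <;> decide
      exact (Nat.pow_le_pow_iff_left (by norm_num)).1 this
    interval_cases n <;> interval_cases b <;> revert h <;> decide
  · rintro ⟨rfl, rfl⟩
    decide
  · by_contra hne
    rcases lt_or_gt_of_ne hne with h3 | h3
    · interval_cases n
      · simp at h
      · rw [prod_Icc_succ_top (by omega)] at h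
        simp at h
        norm_num at h
    -- With real part zero the product is `b * I` for an integer `b`, and its norm `b²` is the
    -- product of the `k² + 1`.
    · obtain ⟨a, b, hab⟩ := exists_int_im_prod_add_I n
      have hN := prod_add_I_normSq n
      rw [hab] at h hN
      have ha : (a : ℝ) = 0 := by simpa using h
      have hb : ((b.natAbs : ℕ) : ℝ) ^ 2 = (b : ℝ) ^ 2 := by
        rw [Nat.cast_natAbs]
        simp
      refine not_isSquare_prod_sq_add_one h3 ⟨b.natAbs, ?_⟩
      have : ((∏ k ∈ Icc 1 n, (k ^ 2 + 1) : ℕ) : ℝ) = ((b.natAbs * b.natAbs : ℕ) : ℝ) := by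
        rw [← hN, Nat.cast_mul, ← pow_two, hb, Complex.normSq_apply]
        simp [ha]
        ring
      exact_mod_cast this
  · rintro rfl
    rw [prod_Icc_succ_top (by omega), prod_Icc_succ_top (by omega)]
    simp
    norm_num
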